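/- Let $(\mathbb M,d)$ be a compact metric space. For a set $X$ with a metric $\rho$, $\varepsilon>0$ and $s\ge 0$ put $$\mathrm H^s_\varepsilon(X,\rho)=\inf\Big\{\sum_{n=1}^\infty(\operatorname{diam}_\rho E_n)^s:\ X=\bigcup_{n=1}^\infty E_n,\ \operatorname{diam}_\rho E_n<\varepsilon\text{ for all }n\Big\}$$ (with $0^0=1$ and $(\operatorname{diam}\emptyset)^s=0$) and $\dim_{\mathrm H}(X,\rho,\varepsilon)=\sup\{s\ge 0:\mathrm H^s_\varepsilon(X,\rho)\ge 1\}\in[0,\infty]$ (with $\sup\emptyset=0$). For $f:X\to X$ and $n\ge1$ let $\rho_n(x,y)=\max_{0\le k<n}\rho(f^k(x),f^k(y))$. The lower and upper mean Hausdorff dimensions of $(X,\rho,f)$ are $$\underline{\mathrm{mdim}}_{\mathrm H}(X,\rho,f)=\lim_{\varepsilon\to0}\liminf_{n\to\infty}\tfrac1n\dim_{\mathrm H}(X,\rho_n,\varepsilon),\qquad \overline{\mathrm{mdim}}_{\mathrm H}(X,\rho,f)=\lim_{\varepsilon\to0}\limsup_{n\to\infty}\tfrac1n\dim_{\mathrm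 H}(X,\rho_n,\varepsilon).$$ Let $\mathbb K=\mathbb N=\{1,2,\dots\}$ or $\mathbb K=\mathbb Z$, let $\mathbb M^{\mathbb K}$ carry the metric $\mathbf d(\bar x,\bar y)=\sum_{j\in\mathbb K}2^{-|j|}d(x_j,y_j)$, and let $\sigma:\mathbb M^{\mathbb K}\to\mathbb M^{\mathbb K}$, $(\sigma\bar x)_j=x_{j+1}$, be the left shift. Let $\dim_{\mathrm H}(\mathbb M,d)$ denote the Hausdorff dimension and $\underline{\dim}_{\mathrm B}(\mathbb M,d)=\liminf_{\varepsilon\to0}\frac{\log N(\varepsilon)}{|\log\varepsilon|}$ the lower box dimension, where $N(\varepsilon)$ is the least number of closed $\varepsilon$-balls covering $\mathbb M$. Suppose that $\dim_{\mathrm H}(\mathbb M,d)=\underline{\dim}_{\mathrm B}(\mathbb M,d)$ (the common value may be $\infty$). Then: 1. for both choices of $\mathbb K$, $\ \underline{\mathrm{mdim}}_{\mathrm H}(\mathbb M^{\mathbb K},\mathbf d,\sigma)=\overline{\mathrm{mdim}}_{\mathrm H}(\mathbb M^{\mathbb K},\mathbf d,\sigma)=\dim_{\mathrm H}(\mathbb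 M,d)$; 2. for every continuous map $f:\mathbb M\to\mathbb M$, $\ \underline{\mathrm{mdim}}_{\mathrm H}(\mathbb M,d,f)\le\overline{\mathrm{mdim}}_{\mathrm H}(\mathbb M,d,f)\le\dim_{\mathrm H}(\mathbb M,d)$. -/

import Mathlib

open Set Filter Topology
open scoped NNReal ENNReal

noncomputable section

namespace MeanHausdorff

/-- The diameter of `E` with respect to a distance function `ρ`, with values in `[0, ∞]`
(the empty set has diameter `0`). -/
def diam {X : Type*} (ρ : X → X → ℝ) (E : Set X) : ℝ≥0∞ :=
  ⨆ x ∈ E, ⨆ y ∈ E, ENNReal.ofReal (ρ x y)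

/-- `H_ε^s(X, ρ)`: the infimum of `∑ (diam E_n)^s` over the countable covers of `X` by sets of
diameter `< ε`. Conventions: `0 ^ 0 = 1`, and an empty `E_n` contributes `0`. -/
def hausdorffContent {X : Type*} (ρ : X → X → ℝ) (ε s : ℝ≥0) : ℝ≥0∞ :=
  ⨅ (E : ℕ → Set X) (_ : ⋃ n, E n = univ) (_ : ∀ n, diam ρ (E n) < ε),
    ∑' n, ⨆ _ : (E n).Nonempty, diam ρ (E n) ^ (s : ℝ)

/-- `dim_H(X, ρ, ε) = sup {s ≥ 0 : H_ε^s(X, ρ) ≥ 1}`, an element of `[0, ∞]`. -/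
def dimScale {X : Type*} (ρ : X → X → ℝ) (ε : ℝ≥0) : ℝ≥0∞ :=
  ⨆ (s : ℝ≥0) (_ : 1 ≤ hausdorffContent ρ ε s), (s : ℝ≥0∞)

/-- The dynamical distance `ρ_n(x, y) = max_{0 ≤ k < n} ρ(f^k x, f^k y)`. -/
def dynDist {X : Type*} (ρ : X → X → ℝ) (f : X → X) (n : ℕ) (x y : X) : ℝ :=
  ⨆ k : Fin n, ρ (f^[k] x) (f^[k] y)

/-- `limsup_n (1/n) dim_H(X, ρ_n, ε)`. -/
def upperRate {X : Type*} (ρ : X → X → ℝ) (f : X → X) (ε : ℝ≥0) : ℝ≥0∞ :=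
  limsup (fun n : ℕ => dimScale (dynDist ρ f n) ε / (n : ℝ≥0∞)) atTop

/-- `liminf_n (1/n) dim_H(X, ρ_n, ε)`. -/
def lowerRate {X : Type*} (ρ : X → X → ℝ) (f : X → X) (ε : ℝ≥0) : ℝ≥0∞ :=
  liminf (fun n : ℕ => dimScale (dynDist ρ f n) ε / (n : ℝ≥0∞)) atTop

/-- The upper mean Hausdorff dimension of `(X, ρ, f)`: the limit of `upperRate` as `ε → 0⁺`
(it always exists, see `tendsto_upperRate`). -/
def upperMdimH {X : Type*} (ρ : X → X → ℝ) (f : X → X) : ℝ≥0∞ :=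
  limUnder (𝓝[>] (0 : ℝ≥0)) (upperRate ρ f)

/-- The lower mean Hausdorff dimension of `(X, ρ, f)`: the limit of `lowerRate` as `ε → 0⁺`
(it always exists, see `tendsto_lowerRate`). -/
def lowerMdimH {X : Type*} (ρ : X → X → ℝ) (f : X → X) : ℝ≥0∞ :=
  limUnder (𝓝[>] (0 : ℝ≥0)) (lowerRate ρ f)

/-- The lower box dimension `liminf_{ε → 0⁺} log N(ε) / |log ε|`, where `N(ε)` is the least
number of closed `ε`-balls that cover `M`. -/
def lowerBoxDim (M : Type*) [MetricSpace M] : ℝ≥0∞ :=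
  liminf (fun ε : ℝ≥0 => ENNReal.ofReal
    (Real.log ((Metric.coveringNumber ε (univ : Set M)).toNat : ℝ) / |Real.log (ε : ℝ)|))
    (𝓝[>] (0 : ℝ≥0))

/-- The distance `∑_{j ∈ K} 2^{-|j|} d(x_j, y_j)` on sequences `K → M`, where `absIdx j` is the
absolute value `|j|` of the index `j`. -/
def prodDist {K M : Type*} [MetricSpace M] (absIdx : K → ℕ) (x y : K → M) : ℝ :=
  ∑' j, 1 / 2 ^ absIdx j * dist (x j) (y j)

/-- The product distance on `M^ℕ`, `ℕ = {1, 2, 3, …}`. -/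
def prodDistNat {M : Type*} [MetricSpace M] : (ℕ+ → M) → (ℕ+ → M) → ℝ :=
  prodDist (fun j : ℕ+ => (j : ℕ))

/-- The product distance on `M^ℤ`. -/
def prodDistInt {M : Type*} [MetricSpace M] : (ℤ → M) → (ℤ → M) → ℝ :=
  prodDist Int.natAbs

/-- The left shift `(σ x)_j = x_{j+1}`. -/
def shift {K M : Type*} [Add K] [One K] (x : K → M) : K → M := fun j => x (j + 1)

/-! The limits and the series in the definitions above exist. -/

theorem hausdorffContent_anti {X : Type*} (ρ : X → X → ℝ) (s : ℝ≥0) {ε δ : ℝ≥0} (h : ε ≤ δ) :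
    hausdorffContent ρ δ s ≤ hausdorffContent ρ ε s := by
  unfold hausdorffContent
  refine le_iInf fun E => le_iInf fun hE => le_iInf fun hd => ?_
  exact iInf_le_of_le E (iInf_le_of_le hE (iInf_le_of_le
    (fun n => (hd n).trans_le (by exact_mod_cast h)) le_rfl))

theorem dimScale_antitone {X : Type*} (ρ : X → X → ℝ) : Antitone (dimScale ρ) := by
  intro ε δ h
  refine iSup_le fun s => iSup_le fun hs => ?_
  exact le_iSup₂_of_le s (hs.trans (hausdorffContent_anti ρ s h)) le_rfl

theorem upperRate_antitone {X : Type*} (ρ : X → X → ℝ) (f : X → X) :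
    Antitone (upperRate ρ f) := by
  intro ε δ h
  exact limsup_le_limsup (Eventually.of_forall fun n =>
    ENNReal.div_le_div_right (dimScale_antitone _ h) _)

theorem lowerRate_antitone {X : Type*} (ρ : X → X → ℝ) (f : X → X) :
    Antitone (lowerRate ρ f) := by
  intro ε δ h
  exact liminf_le_liminf (Eventually.of_forall fun n =>
    ENNReal.div_le_div_right (dimScale_antitone _ h) _)

theorem tendsto_upperRate {X : Type*} (ρ : X → X → ℝ) (f : X → X) :
    Tendsto (upperRate ρ f) (𝓝[>] (0 : ℝ≥0)) (𝓝 (upperMdimH ρ f)) :=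
  tendsto_nhds_limUnder ⟨_, (upperRate_antitone ρ f).tendsto_nhdsGT 0⟩

theorem tendsto_lowerRate {X : Type*} (ρ : X → X → ℝ) (f : X → X) :
    Tendsto (lowerRate ρ f) (𝓝[>] (0 : ℝ≥0)) (𝓝 (lowerMdimH ρ f)) :=
  tendsto_nhds_limUnder ⟨_, (lowerRate_antitone ρ f).tendsto_nhdsGT 0⟩

theorem summable_of_weights {K M : Type*} [MetricSpace M] [CompactSpace M] (absIdx : K → ℕ)
    (hw : Summable fun j => (1 : ℝ) / 2 ^ absIdx j) (x y : K → M) :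
    Summable fun j => (1 : ℝ) / 2 ^ absIdx j * dist (x j) (y j) := by
  refine Summable.of_nonneg_of_le (fun j => by positivity) (fun j => ?_)
    (hw.mul_right (Metric.diam (univ : Set M)))
  exact mul_le_mul_of_nonneg_left
    (Metric.dist_le_diam_of_mem isCompact_univ.isBounded (mem_univ _) (mem_univ _)) (by positivity)

theorem summable_prodDistNat {M : Type*} [MetricSpace M] [CompactSpace M] (x y : ℕ+ → M) :
    Summable fun j : ℕ+ => (1 : ℝ) / 2 ^ (j : ℕ) * dist (x j) (y j) := by
  refine summable_of_weights (fun j : ℕ+ => (j : ℕ)) ?_ x y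
  have h : Summable fun j : ℕ => (1 : ℝ) / 2 ^ j := by
    simpa using summable_geometric_two
  exact h.comp_injective PNat.coe_injective

theorem summable_prodDistInt {M : Type*} [MetricSpace M] [CompactSpace M] (x y : ℤ → M) :
    Summable fun j : ℤ => (1 : ℝ) / 2 ^ j.natAbs * dist (x j) (y j) := by
  refine summable_of_weights Int.natAbs ?_ x y
  have h : Summable fun j : ℕ => (1 : ℝ) / 2 ^ j := by
    simpa using summable_geometric_two
  exact Summable.of_nat_of_neg (by simpa using h) (by simpa using h)

end MeanHausdorff

end

/-!
The lower bound is a mass argument for products. If `s < dim_H M`, then every cover of `M` by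
small sets satisfies `1 ≤ ∑ (diam E)^s`, and this survives for weighted covers, up to an
arbitrarily small loss in `s`: group the sets by dyadic size; each point is heavily covered at
some size, and a maximal separated set of the points heavily covered at a given size yields an
honest cover of comparable mass. A weighted cover of `Mⁿ` by boxes can be sliced along a factor,
giving a weighted cover of that factor whose weights are again sums over a weighted cover of
`Mⁿ⁻¹`. Hence the exponents add up to `n s` at a scale which does not depend on `n`, and it
remains to read the orbit of the shift off a single coordinate.

For the upper bound, `n` iterates of the shift at precision `ε` see only `n + O(1)` coordinates up
to precision comparable to `ε`, so that `N(ε)^(n + O(1))` sets of diameter `O(ε)` suffice; a map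
`f : M → M` is treated in the same way, observing the `n` points of an orbit segment.
-/

namespace MeanHausdorff

section WeightedCover

variable {ι M : Type*}

/-- A weighted (fractional) cover of `M`: sets `E i` with weights `c i` such that the weights of the
sets containing any given point add up to at least one. Unlike genuine covers, weighted covers of a
product can be sliced along its factors. -/
def IsWeightedCover (E : ι → Set M) (c : ι → ℝ≥0∞) : Prop :=
  ∀ x, 1 ≤ ∑' i, (E i).indicator (fun _ => c i) x

theorem isWeightedCover_one_of_iUnion_eq_univ {E : ι → Set M} (hE : ⋃ i, E i = univ) :
    IsWeightedCover E 1 := fun x => by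
  obtain ⟨i, hi⟩ := iUnion_eq_univ_iff.1 hE x
  calc 1 = (E i).indicator (fun _ => 1) x := by simp [hi]
    _ ≤ ∑' i, (E i).indicator (fun _ => 1) x :=
      ENNReal.le_tsum (f := fun i => (E i).indicator (fun _ => 1) x) i

theorem IsWeightedCover.exists_lt_tsum_fiber {J : Type*} {E : ι → Set M} {c : ι → ℝ≥0∞}
    (h : IsWeightedCover E c) (k : ι → J) {δ : J → ℝ≥0∞} (hδ : ∑' j, δ j < 1) (x : M) :
    ∃ j, δ j < ∑' i : k ⁻¹' {j}, (E i).indicator (fun _ => c i) x := by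
  by_contra! hle
  refine (h x).not_gt ?_
  calc ∑' i, (E i).indicator (fun _ => c i) x
      = ∑' j, ∑' i : k ⁻¹' {j}, (E i).indicator (fun _ => c i) x :=
        (ENNReal.tsum_fiberwise _ k).symm
    _ ≤ ∑' j, δ j := ENNReal.tsum_le_tsum hle
    _ < 1 := hδ

theorem IsWeightedCover.one_le_tsum_mul_prod {n : ℕ} {M : Fin n → Type*}
    {A : ι → ∀ l, Set (M l)} {c : ι → ℝ≥0∞} {w : ι → Fin n → ℝ≥0∞}
    (hw : ∀ l c, IsWeightedCover (fun i => A i l) c → 1 ≤ ∑' i, c i * w i l)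
    (h : IsWeightedCover (fun i => univ.pi (A i)) c) :
    1 ≤ ∑' i, c i * ∏ l, w i l := by
  classical
  induction n generalizing c with
  | zero => simpa [IsWeightedCover, indicator] using h finZeroElim
  | succ n ih =>
    have slice (x : M 0) : IsWeightedCover (fun i => univ.pi fun l => A i (Fin.succ l))
        fun i => (A i 0).indicator (fun _ => c i) x := fun y => by
      refine (h (Fin.cons x y)).trans_eq (tsum_congr fun i => ?_)
      simp only [indicator, mem_univ_pi, Fin.forall_fin_succ, Fin.cons_zero, Fin.cons_succ]
      split_ifs <;> tauto
    have first_factor : IsWeightedCover (fun i => A i 0) fun i => c i * ∏ l : Fin n, w i l.succ :=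
      fun x => (ih (fun l => hw l.succ) (slice x)).trans_eq <| tsum_congr fun i => by
        by_cases hx : x ∈ A i 0 <;> simp [hx]
    refine (hw 0 _ first_factor).trans_eq (tsum_congr fun i => ?_)
    rw [Fin.prod_univ_succ, mul_assoc, mul_comm (∏ _, _)]

end WeightedCover

section WeightedHausdorff

variable {ι M : Type*}

theorem exists_maximal_isSeparated [PseudoEMetricSpace M] (r : ℝ≥0∞) (A : Set M) :
    ∃ P, Maximal (fun P => P ⊆ A ∧ Metric.IsSeparated r P) P :=
  zorn_subset {P | P ⊆ A ∧ Metric.IsSeparated r P} fun 𝒞 h𝒞 hchain =>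
    ⟨⋃₀ 𝒞, ⟨sUnion_subset fun _ hP => (h𝒞 hP).1,
      (pairwise_sUnion hchain.directedOn).2 fun _ hP => (h𝒞 hP).2⟩,
      fun _ => subset_sUnion_of_mem⟩

theorem tsum_indicator_le_of_isSeparated [PseudoEMetricSpace M] {r : ℝ≥0∞} {P E : Set M}
    (hP : Metric.IsSeparated r P) (hE : Metric.ediam E ≤ r) (a : ℝ≥0∞) :
    ∑' p : P, E.indicator (fun _ => a) (p : M) ≤ a := by
  by_cases hmeet : ∃ p : P, (p : M) ∈ E
  · obtain ⟨p, hp⟩ := hmeet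
    rw [tsum_eq_single p]
    · exact indicator_le_self' (fun _ _ => zero_le) _
    · intro p' hne
      refine indicator_of_notMem (fun hp' => ?_) _
      exact (hP p'.2 p.2 (Subtype.coe_injective.ne hne)).not_ge
        ((Metric.edist_le_ediam_of_mem hp' hp).trans hE)
  · simp [indicator_of_notMem (not_exists.1 hmeet _)]

theorem encard_mul_le_tsum_of_isSeparated [PseudoEMetricSpace M] {r δ : ℝ≥0∞} {P : Set M}
    {E : ι → Set M} {c : ι → ℝ≥0∞} (hP : Metric.IsSeparated r P)
    (hE : ∀ i, Metric.ediam (E i) ≤ r)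
    (hδ : ∀ p ∈ P, δ ≤ ∑' i, (E i).indicator (fun _ => c i) p) :
    P.encard * δ ≤ ∑' i, c i := by
  calc P.encard * δ = ∑' _ : P, δ := (ENNReal.tsum_set_const P δ).symm
    _ ≤ ∑' p : P, ∑' i, (E i).indicator (fun _ => c i) (p : M) :=
      ENNReal.tsum_le_tsum fun p => hδ p p.2
    _ = ∑' i, ∑' p : P, (E i).indicator (fun _ => c i) (p : M) := ENNReal.tsum_comm
    _ ≤ ∑' i, c i :=
      ENNReal.tsum_le_tsum fun i => tsum_indicator_le_of_isSeparated hP (hE i) (c i)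

/-- A dyadic net of `M`: sets `P j` of centers, one for each scale `2⁻ʲ`, whose closed balls of
radius `2⁻ʲ` cover `M` when all scales are taken together. -/
def IsDyadicNet [PseudoEMetricSpace M] (P : ℕ → Set M) : Prop :=
  ∀ x, ∃ j, ∃ p ∈ P j, edist x p ≤ 2⁻¹ ^ j

/- Every point is heavily covered at some scale `j`; the centers at scale `j` are a maximal
separated set of points that are heavily covered there. -/
theorem IsWeightedCover.exists_isDyadicNet [PseudoEMetricSpace M] {E : ι → Set M}
    {c : ι → ℝ≥0∞} {k : ι → ℕ} {δ : ℕ → ℝ≥0∞} (h : IsWeightedCover E c)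
    (hE : ∀ i, Metric.ediam (E i) ≤ 2⁻¹ ^ k i) (hδ : ∑' j, δ j < 1) :
    ∃ P : ℕ → Set M, IsDyadicNet P ∧ (∀ j, (P j).Nonempty → j ∈ range k) ∧
      ∀ j, (P j).encard * δ j ≤ ∑' i : k ⁻¹' {j}, c i := by
  have coe_radius (j : ℕ) : ((2⁻¹ ^ j : ℝ≥0) : ℝ≥0∞) = 2⁻¹ ^ j := by
    push_cast [ENNReal.coe_inv two_ne_zero]; rfl
  let heavy (j : ℕ) : Set M := {x | δ j < ∑' i : k ⁻¹' {j}, (E i).indicator (fun _ => c i) x}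
  choose P hP using fun j => exists_maximal_isSeparated ((2⁻¹ ^ j : ℝ≥0) : ℝ≥0∞) (heavy j)
  refine ⟨P, fun x => ?_, fun j ⟨p, hp⟩ => ?_, fun j => ?_⟩
  · obtain ⟨j, hj⟩ := h.exists_lt_tsum_fiber k hδ x
    obtain ⟨p, hp, hxp⟩ := Metric.IsCover.of_maximal_isSeparated (hP j) hj
    exact ⟨j, p, hp, hxp.trans_eq (coe_radius j)⟩
  · have hpos : 0 < ∑' i : k ⁻¹' {j}, (E i).indicator (fun _ => c i) p :=
      zero_le.trans_lt ((hP j).prop.1 hp)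
    obtain ⟨i, -⟩ := not_forall.1 (mt ENNReal.tsum_eq_zero.2 hpos.ne')
    exact ⟨i, i.2⟩
  · refine encard_mul_le_tsum_of_isSeparated (hP j).prop.2 (fun i => ?_)
      fun p hp => ((hP j).prop.1 hp).le
    exact (hE i).trans_eq ((congrArg (2⁻¹ ^ ·) i.2).trans (coe_radius j).symm)

/- The threshold for being heavily covered at scale `j` is a multiple of `2^(-(u - s) j)`, which is
summable and accounts for the loss in the exponent. -/
theorem exists_tsum_encard_mul_rpow_le {s u : ℝ} (hsu : s < u) : ∃ B : ℝ≥0∞, B ≠ ∞ ∧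
    ∀ {ι M : Type*} [PseudoEMetricSpace M] {E : ι → Set M} {c : ι → ℝ≥0∞} {k : ι → ℕ},
      IsWeightedCover E c → (∀ i, Metric.ediam (E i) ≤ 2⁻¹ ^ k i) →
      ∃ P : ℕ → Set M, IsDyadicNet P ∧ (∀ j, (P j).Nonempty → j ∈ range k) ∧
        ∑' j, (P j).encard * ((2⁻¹ : ℝ≥0∞) ^ j) ^ u ≤
          B * ∑' i, c i * ((2⁻¹ : ℝ≥0∞) ^ k i) ^ s := by
  set q : ℝ≥0∞ := 2⁻¹ ^ (u - s) with hq
  have hq1 : q < 1 := ENNReal.rpow_lt_one (by simp) (by linarith)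
  have hκ0 : (1 - q) / 2 ≠ 0 := by simp [tsub_eq_zero_iff_le, hq1]
  have hκt : (1 - q) / 2 ≠ ∞ := ENNReal.div_ne_top (by simp) two_ne_zero
  have hδ : ∑' j, (1 - q) / 2 * q ^ j < 1 := by
    rw [ENNReal.tsum_mul_left, ENNReal.tsum_geometric, mul_comm, ← mul_div_assoc,
      ENNReal.inv_mul_cancel (tsub_pos_of_lt hq1).ne' (by simp)]
    simp
  have split_exponent (j : ℕ) : ((2⁻¹ : ℝ≥0∞) ^ j) ^ u = q ^ j * ((2⁻¹ : ℝ≥0∞) ^ j) ^ s := by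
    rw [hq, ← ENNReal.rpow_natCast (2⁻¹ ^ (u - s)), ← ENNReal.rpow_mul, mul_comm (u - s),
      ENNReal.rpow_mul, ENNReal.rpow_natCast, ← ENNReal.rpow_add _ _ (by simp) (by simp),
      sub_add_cancel]
  refine ⟨((1 - q) / 2)⁻¹, ENNReal.inv_ne_top.2 hκ0, fun {ι M _ E c k} h hE => ?_⟩
  obtain ⟨P, hnet, hrange, hcard⟩ := h.exists_isDyadicNet hE hδ
  refine ⟨P, hnet, hrange, ?_⟩
  calc ∑' j, (P j).encard * ((2⁻¹ : ℝ≥0∞) ^ j) ^ u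
      = ∑' j, ((1 - q) / 2)⁻¹ *
          ((P j).encard * ((1 - q) / 2 * q ^ j) * ((2⁻¹ : ℝ≥0∞) ^ j) ^ s) := by
        refine tsum_congr fun j => ?_
        rw [split_exponent]
        calc _ = (((1 - q) / 2)⁻¹ * ((1 - q) / 2)) *
              ((P j).encard * (q ^ j * ((2⁻¹ : ℝ≥0∞) ^ j) ^ s)) := by
              rw [ENNReal.inv_mul_cancel hκ0 hκt, one_mul]
          _ = _ := by ring
    _ ≤ ∑' j, ((1 - q) / 2)⁻¹ * ((∑' i : k ⁻¹' {j}, c i) * ((2⁻¹ : ℝ≥0∞) ^ j) ^ s) := by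
        gcongr with j
        exact hcard j
    _ = ((1 - q) / 2)⁻¹ * ∑' j, ∑' i : k ⁻¹' {j}, c i * ((2⁻¹ : ℝ≥0∞) ^ k i) ^ s := by
        rw [ENNReal.tsum_mul_left]
        congr! 3 with j
        rw [← ENNReal.tsum_mul_right]
        exact tsum_congr fun i => by rw [show k i = j from i.2]
    _ = ((1 - q) / 2)⁻¹ * ∑' i, c i * ((2⁻¹ : ℝ≥0∞) ^ k i) ^ s := by
        rw [ENNReal.tsum_fiberwise (fun i => c i * ((2⁻¹ : ℝ≥0∞) ^ k i) ^ s) k]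

open MeasureTheory Measure in
theorem hausdorffMeasure_univ_le_of_isDyadicNet [EMetricSpace M] [MeasurableSpace M]
    [BorelSpace M] {u : ℝ} (hu : 0 ≤ u) {B : ℝ≥0∞} (hB : B ≠ ∞)
    (hP : ∀ n : ℕ, ∃ P : ℕ → Set M, IsDyadicNet P ∧ (∀ j, (P j).Nonempty → n ≤ j) ∧
      ∑' j, (P j).encard * ((2⁻¹ : ℝ≥0∞) ^ j) ^ u ≤ B) :
    μH[u] (univ : Set M) ≤ 2 ^ u * B := by
  choose P hnet hfine hsum using hP
  have hfin (n j : ℕ) : (P n j).Finite := by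
    refine encard_ne_top_iff.1 fun htop => hB (top_le_iff.1 ?_)
    have hpos : ((2⁻¹ : ℝ≥0∞) ^ j) ^ u ≠ 0 := by simp [ENNReal.rpow_eq_zero_iff]
    simpa [htop, ENNReal.top_mul hpos] using (ENNReal.le_tsum j).trans (hsum n)
  have (n j : ℕ) : Countable (P n j) := (hfin n j).countable.to_subtype
  let ball (n : ℕ) (p : Σ j, P n j) : Set M := Metric.closedEBall (p.2 : M) (2⁻¹ ^ p.1)
  have hdiam (n : ℕ) (p : Σ j, P n j) : Metric.ediam (ball n p) ≤ 2 * 2⁻¹ ^ p.1 :=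
    Metric.ediam_closedEBall_le
  have hscale : Tendsto (fun n : ℕ => 2 * (2⁻¹ : ℝ≥0∞) ^ n) atTop (𝓝 0) := by
    simpa using ENNReal.Tendsto.const_mul (a := 2)
      (ENNReal.tendsto_pow_atTop_nhds_zero_of_lt_one (r := 2⁻¹) (by simp)) (.inr (by simp))
  have hsmall (n : ℕ) (p : Σ j, P n j) : Metric.ediam (ball n p) ≤ 2 * 2⁻¹ ^ n := by
    refine (hdiam n p).trans ?_
    gcongr 2 * ?_
    exact pow_le_pow_right_of_le_one' (by simp) (hfine n p.1 ⟨p.2, p.2.2⟩)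
  have hcover (n : ℕ) : (univ : Set M) ⊆ ⋃ p, ball n p := fun x _ => by
    obtain ⟨j, p, hp, hxp⟩ := hnet n x
    exact mem_iUnion.2 ⟨⟨j, p, hp⟩, hxp⟩
  have hmass (n : ℕ) : ∑' p, Metric.ediam (ball n p) ^ u ≤ 2 ^ u * B := by
    calc ∑' p, Metric.ediam (ball n p) ^ u
        ≤ ∑' p : Σ j, P n j, 2 ^ u * ((2⁻¹ : ℝ≥0∞) ^ p.1) ^ u := by
          refine ENNReal.tsum_le_tsum fun p => ?_
          rw [← ENNReal.mul_rpow_of_nonneg _ _ hu]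
          exact ENNReal.rpow_le_rpow (hdiam n p) hu
      _ = 2 ^ u * ∑' j, (P n j).encard * ((2⁻¹ : ℝ≥0∞) ^ j) ^ u := by
          simp only [ENNReal.tsum_mul_left, ENNReal.tsum_sigma', ENNReal.tsum_set_const]
      _ ≤ 2 ^ u * B := by gcongr; exact hsum n
  calc μH[u] (univ : Set M)
      ≤ liminf (fun n => ∑' p, Metric.ediam (ball n p) ^ u) atTop :=
        hausdorffMeasure_le_liminf_tsum u univ _ hscale ball (.of_forall hsmall)
          (.of_forall hcover)
    _ ≤ liminf (fun _ : ℕ => 2 ^ u * B) atTop := liminf_le_liminf (.of_forall hmass)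
    _ = 2 ^ u * B := liminf_const _

theorem exists_one_le_tsum_mul_dyadic_rpow_of_lt_dimH [EMetricSpace M] {s : ℝ≥0}
    (hs : s < dimH (univ : Set M)) :
    ∃ k₀ : ℕ, ∀ {E : ι → Set M} {c : ι → ℝ≥0∞} {k : ι → ℕ}, IsWeightedCover E c →
      (∀ i, Metric.ediam (E i) ≤ 2⁻¹ ^ k i) → (∀ i, k₀ ≤ k i) →
      1 ≤ ∑' i, c i * ((2⁻¹ : ℝ≥0∞) ^ k i) ^ (s : ℝ) := by
  obtain ⟨u, hsu, hu⟩ := ENNReal.lt_iff_exists_nnreal_btwn.1 hs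
  obtain ⟨B, hB, hnet⟩ := exists_tsum_encard_mul_rpow_le
    (NNReal.coe_lt_coe.2 (ENNReal.coe_lt_coe.1 hsu))
  borelize M
  by_contra! hlight
  have hfinite : MeasureTheory.Measure.hausdorffMeasure u (univ : Set M) ≤ 2 ^ (u : ℝ) * B := by
    refine hausdorffMeasure_univ_le_of_isDyadicNet u.coe_nonneg hB fun n => ?_
    obtain ⟨E, c, k, hcover, hE, hk, hlt⟩ := hlight n
    obtain ⟨P, hP, hrange, hsum⟩ := hnet hcover hE
    refine ⟨P, hP, fun j hj => ?_, hsum.trans (mul_le_of_le_one_right' hlt.le)⟩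
    obtain ⟨i, rfl⟩ := hrange j hj
    exact hk i
  rw [hausdorffMeasure_of_lt_dimH hu, top_le_iff] at hfinite
  exact ENNReal.mul_ne_top (ENNReal.rpow_ne_top_of_nonneg u.coe_nonneg (by simp)) hB hfinite

theorem exists_dyadic_mem_Ico {r : ℝ≥0∞} (h0 : r ≠ 0) (h1 : r ≤ 1) :
    ∃ k : ℕ, (2⁻¹ : ℝ≥0∞) ^ k ∈ Ico r (2 * r) := by
  lift r to ℝ≥0 using ne_top_of_le_ne_top ENNReal.one_ne_top h1
  obtain ⟨k, hlt, hle⟩ := exists_nat_pow_near_of_lt_one (y := (2⁻¹ : ℝ≥0))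
    (pos_iff_ne_zero.2 (ENNReal.coe_ne_zero.1 h0)) (ENNReal.coe_le_one_iff.1 h1) (by simp)
    (inv_lt_one_of_one_lt₀ one_lt_two)
  have hlt' : 2⁻¹ ^ k < 2 * r := by
    rwa [pow_succ', inv_mul_lt_iff₀ two_pos] at hlt
  rw [← ENNReal.coe_two, ← ENNReal.coe_inv two_ne_zero]
  exact ⟨k, mod_cast hle, mod_cast hlt'⟩

theorem eventually_mul_rpow_le_rpow {s s' : ℝ} (hs' : 0 ≤ s') (h : s' < s) (A : ℝ≥0) :
    ∀ᶠ r : ℝ≥0∞ in 𝓝 0, (A * r) ^ s ≤ r ^ s' := by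
  have hs : 0 ≤ s := hs'.trans h.le
  have hlim : Tendsto (fun r : ℝ≥0∞ => (A : ℝ≥0∞) ^ s * r ^ (s - s')) (𝓝 0) (𝓝 0) := by
    refine Continuous.tendsto' ?_ 0 0 ?_
    · exact (ENNReal.continuous_const_mul (ENNReal.rpow_ne_top_of_nonneg hs (by simp))).comp
        ENNReal.continuous_rpow_const
    · rw [ENNReal.zero_rpow_of_pos (sub_pos.2 h), mul_zero]
  filter_upwards [hlim.eventually_le_const one_pos] with r hr
  calc (A * r) ^ s = A ^ s * r ^ (s - s') * r ^ s' := by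
        rw [mul_assoc, ← ENNReal.rpow_add_of_nonneg _ _ (sub_nonneg.2 h.le) hs', sub_add_cancel,
          ENNReal.mul_rpow_of_nonneg _ _ hs]
    _ ≤ r ^ s' := mul_le_of_le_one_left' hr

theorem exists_one_le_tsum_mul_rpow_of_lt_dimH [EMetricSpace M] {s : ℝ≥0}
    (hs : s < dimH (univ : Set M)) (C : ℝ≥0) :
    ∃ ε : ℝ≥0, 0 < ε ∧ ∀ {E : ι → Set M} {c r : ι → ℝ≥0∞}, IsWeightedCover E c →
      (∀ i, Metric.ediam (E i) ≤ C * r i) → (∀ i, r i ∈ Ioo 0 (ε : ℝ≥0∞)) →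
      1 ≤ ∑' i, c i * r i ^ (s : ℝ) := by
  obtain ⟨t, hst, ht⟩ := ENNReal.lt_iff_exists_nnreal_btwn.1 hs
  obtain ⟨k₀, hk₀⟩ := exists_one_le_tsum_mul_dyadic_rpow_of_lt_dimH (ι := ι) ht
  have htiny : ∀ᶠ r : ℝ≥0∞ in 𝓝 0, ((2 * (C + 1) : ℝ≥0) : ℝ≥0∞) * r ≤ 2⁻¹ ^ k₀ :=
    ((ENNReal.continuous_const_mul ENNReal.coe_ne_top).tendsto' 0 0 (mul_zero _)
      ).eventually_le_const (ENNReal.pow_pos (by simp) k₀)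
  obtain ⟨ε', hε', hr⟩ := ENNReal.nhds_zero_basis.eventually_iff.1 <| htiny.and <|
    eventually_mul_rpow_le_rpow s.coe_nonneg
      (NNReal.coe_lt_coe.2 (ENNReal.coe_lt_coe.1 hst)) (2 * (C + 1))
  obtain ⟨ε, hε, hεε'⟩ := ENNReal.lt_iff_exists_nnreal_btwn.1 hε'
  refine ⟨ε, ENNReal.coe_pos.1 hε, fun {E c r} hcover hE hmem => ?_⟩
  have exists_level (i : ι) : ∃ k : ℕ, k₀ ≤ k ∧ C * r i ≤ 2⁻¹ ^ k ∧
      ((2⁻¹ : ℝ≥0∞) ^ k) ^ (t : ℝ) ≤ r i ^ (s : ℝ) := by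
    obtain ⟨hsmall, hpow⟩ := hr ((hmem i).2.trans hεε')
    push_cast [mul_assoc] at hsmall hpow
    obtain ⟨k, hle, hlt⟩ := exists_dyadic_mem_Ico (r := (C + 1) * r i)
      (mul_ne_zero (by simp) (hmem i).1.ne')
      ((le_mul_of_one_le_left' one_le_two).trans (hsmall.trans (pow_le_one' (by simp) _)))
    refine ⟨k, ?_, le_trans (by gcongr; exact le_self_add) hle,
      (ENNReal.rpow_le_rpow hlt.le t.coe_nonneg).trans hpow⟩
    by_contra! hk
    exact (hlt.trans_le hsmall).not_ge (pow_le_pow_right_of_le_one' (by simp) hk.le)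
  choose k hk hCr hrk using exists_level
  exact (hk₀ hcover (fun i => (hE i).trans (hCr i)) hk).trans (by gcongr with i; exact hrk i)

end WeightedHausdorff

section Diam

variable {X : Type*} {ρ : X → X → ℝ} {E : Set X}

theorem diam_le {r : ℝ≥0∞} (h : ∀ x ∈ E, ∀ y ∈ E, ENNReal.ofReal (ρ x y) ≤ r) : diam ρ E ≤ r :=
  iSup₂_le fun x hx => iSup₂_le (h x hx)

theorem ofReal_le_diam {x y : X} (hx : x ∈ E) (hy : y ∈ E) :
    ENNReal.ofReal (ρ x y) ≤ diam ρ E :=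
  le_iSup₂_of_le x hx (le_iSup₂ (f := fun y _ => ENNReal.ofReal (ρ x y)) y hy)

theorem diam_empty : diam ρ ∅ = 0 := by
  simp [diam]

theorem diam_rpow_le_iSup_nonempty {p : ℝ} (hp : 0 < p) :
    diam ρ E ^ p ≤ ⨆ _ : E.Nonempty, diam ρ E ^ p := by
  obtain rfl | hE := E.eq_empty_or_nonempty
  · simp [diam_empty, ENNReal.zero_rpow_of_pos hp]
  · exact le_iSup (fun _ : E.Nonempty => diam ρ E ^ p) hE

end Diam

section DynDist

variable {X : Type*} {ρ : X → X → ℝ} {f : X → X} {n : ℕ}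

theorem le_dynDist {l : ℕ} (hl : l < n) (x y : X) :
    ρ (f^[l] x) (f^[l] y) ≤ dynDist ρ f n x y :=
  le_ciSup (f := fun k : Fin n => ρ (f^[k] x) (f^[k] y)) (finite_range _).bddAbove ⟨l, hl⟩

theorem dynDist_le {x y : X} {r : ℝ} (hr : 0 ≤ r) (h : ∀ l < n, ρ (f^[l] x) (f^[l] y) ≤ r) :
    dynDist ρ f n x y ≤ r :=
  Real.iSup_le (fun k => h k k.2) hr

theorem lowerMdimH_le_upperMdimH (ρ : X → X → ℝ) (f : X → X) :
    lowerMdimH ρ f ≤ upperMdimH ρ f :=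
  le_of_tendsto_of_tendsto' (tendsto_lowerRate ρ f) (tendsto_upperRate ρ f) fun _ =>
    liminf_le_limsup

end DynDist

section LowerBound

theorem exists_gt_tsum_rpow_le {ι : Type*} [Countable ι] {D : ι → ℝ≥0∞} {ε η : ℝ≥0∞} {p : ℝ}
    (hD : ∀ i, D i < ε) (hp : 0 ≤ p) (hη : η ≠ 0) :
    ∃ r : ι → ℝ≥0∞, (∀ i, r i ∈ Ioo (D i) ε) ∧ ∑' i, r i ^ p ≤ ∑' i, D i ^ p + η := by
  obtain ⟨η', hη', hsum⟩ := ENNReal.exists_pos_sum_of_countable' hη ι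
  have exists_radius (i : ι) : ∃ r ∈ Ioo (D i) ε, r ^ p ≤ D i ^ p + η' i := by
    have hfin : D i ^ p ≠ ∞ := ENNReal.rpow_ne_top_of_nonneg hp (hD i).ne_top
    have := nhdsGT_neBot_of_exists_gt ⟨ε, hD i⟩
    have hnear : ∀ᶠ r in 𝓝[>] D i, r ^ p ≤ D i ^ p + η' i :=
      (ENNReal.continuous_rpow_const.tendsto _ |>.mono_left nhdsWithin_le_nhds).eventually_le_const
        (ENNReal.lt_add_right hfin (hη' i).ne')
    obtain ⟨r, hpow, hmem⟩ := (hnear.and (Ioo_mem_nhdsGT (hD i))).exists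
    exact ⟨r, hmem, hpow⟩
  choose r hmem hpow using exists_radius
  refine ⟨r, hmem, ?_⟩
  calc ∑' i, r i ^ p ≤ ∑' i, (D i ^ p + η' i) := ENNReal.tsum_le_tsum hpow
    _ = ∑' i, D i ^ p + ∑' i, η' i := ENNReal.tsum_add
    _ ≤ ∑' i, D i ^ p + η := by gcongr

variable {X M : Type*} [EMetricSpace M] {C : ℝ≥0}

/- Project a cover of `X` to the `n` factors; its boxes cover `Mⁿ`, and each factor contributes
the exponent `s`. -/
theorem exists_one_le_hausdorffContent_mul {s : ℝ≥0} (hs0 : 0 < s)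
    (hs : s < dimH (univ : Set M)) (C : ℝ≥0) :
    ∃ ε : ℝ≥0, 0 < ε ∧ ∀ {n : ℕ} {ρ : X → X → ℝ} {π : Fin n → X → M}, n ≠ 0 →
      Function.Surjective (fun x l => π l x) →
      (∀ l x y, edist (π l x) (π l y) ≤ C * ENNReal.ofReal (ρ x y)) →
      1 ≤ hausdorffContent ρ ε (n * s) := by
  obtain ⟨ε, hε, hweight⟩ := exists_one_le_tsum_mul_rpow_of_lt_dimH (ι := ℕ) hs C
  refine ⟨ε, hε, fun {n ρ π} hn hsurj hπ => le_iInf fun E => le_iInf₂ fun hE hdiam => ?_⟩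
  have hp : 0 < ((n * s : ℝ≥0) : ℝ) := by positivity
  refine ENNReal.le_of_forall_pos_le_add fun η hη _ => ?_
  obtain ⟨r, hr, hsum⟩ := exists_gt_tsum_rpow_le hdiam hp.le (ENNReal.coe_ne_zero.2 hη.ne')
  have box_cover : IsWeightedCover (fun i => univ.pi fun l => π l '' E i) 1 := by
    refine isWeightedCover_one_of_iUnion_eq_univ (iUnion_eq_univ_iff.2 fun y => ?_)
    obtain ⟨x, rfl⟩ := hsurj y
    obtain ⟨i, hi⟩ := iUnion_eq_univ_iff.1 hE x
    exact ⟨i, fun l _ => mem_image_of_mem _ hi⟩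
  have ediam_side_le (l : Fin n) (i : ℕ) : Metric.ediam (π l '' E i) ≤ C * r i := by
    refine Metric.ediam_image_le_iff.2 fun x hx y hy => (hπ l x y).trans ?_
    gcongr
    exact (ofReal_le_diam hx hy).trans (hr i).1.le
  calc 1 ≤ ∑' i, 1 * ∏ _l : Fin n, r i ^ (s : ℝ) :=
        box_cover.one_le_tsum_mul_prod fun l c hc => hweight hc (ediam_side_le l) fun i =>
          ⟨zero_le.trans_lt (hr i).1, (hr i).2⟩
    _ = ∑' i, r i ^ ((n * s : ℝ≥0) : ℝ) := by
        simp [mul_comm (n : ℝ), ENNReal.rpow_mul]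
    _ ≤ ∑' i, diam ρ (E i) ^ ((n * s : ℝ≥0) : ℝ) + η := hsum
    _ ≤ _ := by gcongr; exact diam_rpow_le_iSup_nonempty hp

theorem dimH_le_lowerMdimH_of_surjective_itinerary {ρ : X → X → ℝ} {f : X → X} {π : X → M}
    (hπ : ∀ x y, edist (π x) (π y) ≤ C * ENNReal.ofReal (ρ x y))
    (hsurj : Function.Surjective fun x (l : ℕ) => π (f^[l] x)) :
    dimH (univ : Set M) ≤ lowerMdimH ρ f := by
  refine ENNReal.le_of_forall_nnreal_lt fun s hs => ?_
  obtain rfl | hs0 := eq_zero_or_pos s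
  · simp
  obtain ⟨ε, hε, hcontent⟩ := exists_one_le_hausdorffContent_mul (X := X) hs0 hs C
  have le_dimScale {n : ℕ} (hn : n ≠ 0) : ((n * s : ℝ≥0) : ℝ≥0∞) ≤ dimScale (dynDist ρ f n) ε := by
    refine le_iSup₂_of_le (n * s) (hcontent (π := fun l x => π (f^[l] x)) hn ?_ ?_) le_rfl
    · intro y
      have : Nonempty M := ⟨y ⟨0, hn.bot_lt⟩⟩
      obtain ⟨z, rfl⟩ := Fin.val_injective.surjective_comp_right y
      obtain ⟨x, rfl⟩ := hsurj z
      exact ⟨x, rfl⟩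
    · intro l x y
      refine (hπ _ _).trans ?_
      gcongr
      exact le_dynDist l.2 x y
  have le_lowerRate : (s : ℝ≥0∞) ≤ lowerRate ρ f ε := by
    refine le_liminf_of_le (by isBoundedDefault) ?_
    filter_upwards [eventually_ne_atTop 0] with n hn
    rw [ENNReal.le_div_iff_mul_le (by simp [hn]) (by simp), mul_comm]
    exact mod_cast le_dimScale hn
  refine ge_of_tendsto (tendsto_lowerRate ρ f) ?_
  filter_upwards [Ioo_mem_nhdsGT hε] with δ hδ
  exact le_lowerRate.trans (lowerRate_antitone ρ f hδ.2.le)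

end LowerBound

section UpperBound

variable {X : Type*} {ρ : X → X → ℝ}

theorem hausdorffContent_le_card_mul {ι : Type*} [Fintype ι] {F : ι → Set X} {r ε : ℝ≥0}
    (hF : ⋃ i, F i = univ) (hd : ∀ i, diam ρ (F i) ≤ r) (hr : r < ε) (s : ℝ≥0) :
    hausdorffContent ρ ε s ≤ Fintype.card ι * (r : ℝ≥0∞) ^ (s : ℝ) := by
  have := Fintype.toEncodable ι
  refine iInf_le_of_le (fun n => ⋃ i ∈ Encodable.decode₂ ι n, F i) <| iInf₂_le_of_le
    ((Encodable.iUnion_decode₂ F).trans hF) (fun n => ?_) ?_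
  · refine lt_of_le_of_lt ?_ (ENNReal.coe_lt_coe.2 hr)
    exact Encodable.iUnion_decode₂_cases (C := fun E => diam ρ E ≤ r) (by simp [diam_empty]) hd
  · rw [tsum_iUnion_decode₂ (m := fun E : Set X => ⨆ _ : E.Nonempty, diam ρ E ^ (s : ℝ)) (by simp)]
    calc ∑' i, ⨆ _ : (F i).Nonempty, diam ρ (F i) ^ (s : ℝ)
        ≤ ∑' _ : ι, (r : ℝ≥0∞) ^ (s : ℝ) :=
          ENNReal.tsum_le_tsum fun i => iSup_le fun _ => ENNReal.rpow_le_rpow (hd i) s.coe_nonneg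
      _ = Fintype.card ι * (r : ℝ≥0∞) ^ (s : ℝ) := by simp [tsum_fintype]

theorem dimScale_le_log_card_div {ι : Type*} [Fintype ι] {F : ι → Set X} {R δ : ℝ≥0}
    (hF : ⋃ i, F i = univ) (hd : ∀ i, diam ρ (F i) ≤ R) (hR0 : 0 < R) (hR1 : R < 1)
    (hRδ : R < δ) :
    dimScale ρ δ ≤ ENNReal.ofReal (Real.log (Fintype.card ι) / |Real.log R|) := by
  have hlogR : Real.log R < 0 := Real.log_neg hR0 hR1
  refine iSup₂_le fun s hs => ?_
  have one_le : (1 : ℝ) ≤ Fintype.card ι * (R : ℝ) ^ (s : ℝ) := by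
    have := hs.trans (hausdorffContent_le_card_mul hF hd hRδ s)
    rw [← ENNReal.coe_rpow_of_nonneg _ s.coe_nonneg] at this
    exact mod_cast this
  have log_nonneg : 0 ≤ Real.log (Fintype.card ι) + s * Real.log R := by
    rw [← Real.log_rpow (by exact hR0), ← Real.log_mul _ (by positivity)]
    · exact Real.log_nonneg one_le
    · exact left_ne_zero_of_mul (one_pos.trans_le one_le).ne'
  rw [← ENNReal.ofReal_coe_nnreal]
  refine ENNReal.ofReal_le_ofReal ((le_div_iff₀ (abs_pos.2 hlogR.ne)).2 ?_)
  rw [abs_of_neg hlogR]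
  linarith

variable {M K : Type*}

theorem dimScale_le_card_mul_log_coveringNumber_div [PseudoMetricSpace M] {ι : Type*} [Fintype ι]
    {T : ι → X → M} {ε R δ : ℝ≥0} (hN : Metric.coveringNumber ε (univ : Set M) ≠ ⊤)
    (hT : ∀ x y, (∀ j, dist (T j x) (T j y) ≤ 2 * ε) → ρ x y ≤ R)
    (hR0 : 0 < R) (hR1 : R < 1) (hRδ : R < δ) :
    dimScale ρ δ ≤ ENNReal.ofReal (Fintype.card ι *
      (Real.log (Metric.coveringNumber ε (univ : Set M)).toNat / |Real.log R|)) := by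
  classical
  obtain ⟨S, -, hfin, hcov, hcard⟩ := Metric.exists_set_encard_eq_coveringNumber hN
  have : Fintype S := hfin.fintype
  have card_S : (Metric.coveringNumber ε (univ : Set M)).toNat = Fintype.card S := by
    rw [← hcard, encard_eq_coe_toFinset_card, ENat.toNat_natCast, toFinset_card]
  let box (g : ι → S) : Set X := {x | ∀ j, dist (T j x) (g j) ≤ ε}
  have box_cover : ⋃ g, box g = univ := iUnion_eq_univ_iff.2 fun x => by
    choose g hgS hg using fun j => hcov (mem_univ (T j x))
    exact ⟨fun j => ⟨g j, hgS j⟩, fun j => edist_le_coe.1 (hg j)⟩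
  have diam_box (g : ι → S) : diam ρ (box g) ≤ R := diam_le fun x hx y hy =>
    ENNReal.ofReal_le_of_le_toReal <| hT x y fun j =>
      (dist_triangle_right _ _ (g j : M)).trans <| by linarith [hx j, hy j]
  have := dimScale_le_log_card_div box_cover diam_box hR0 hR1 hRδ
  rwa [Fintype.card_fun, Nat.cast_pow, Real.log_pow, mul_div_assoc, ← card_S] at this

theorem limsup_div_natCast_le {u : ℕ → ℝ≥0∞} {m : ℕ} {v : ℝ}
    (hu : ∀ n, u n ≤ ENNReal.ofReal ((n + m : ℕ) * v)) :
    limsup (fun n : ℕ => u n / (n : ℝ≥0∞)) atTop ≤ ENNReal.ofReal v := by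
  have hlim : Tendsto (fun n : ℕ => ENNReal.ofReal ((1 + m / n) * v)) atTop
      (𝓝 (ENNReal.ofReal v)) := by
    refine ENNReal.tendsto_ofReal ?_
    simpa using ((tendsto_const_div_atTop_nhds_zero_nat (m : ℝ)).const_add 1).mul_const v
  rw [← hlim.limsup_eq]
  refine limsup_le_limsup ?_
  filter_upwards [eventually_gt_atTop 0] with n hn
  calc u n / (n : ℝ≥0∞) ≤ ENNReal.ofReal ((n + m : ℕ) * v) / ENNReal.ofReal n := by
        rw [ENNReal.ofReal_natCast]
        exact ENNReal.div_le_div_right (hu n) _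
    _ = ENNReal.ofReal ((1 + m / n) * v) := by
        rw [← ENNReal.ofReal_div_of_pos (by positivity)]
        congr 1
        push_cast
        field_simp

theorem tendsto_log_const_mul_div_log {C : ℝ} (hC : C ≠ 0) :
    Tendsto (fun x : ℝ => Real.log (C * x) / Real.log x) (𝓝[>] 0) (𝓝 1) := by
  have hlim : Tendsto (fun x : ℝ => Real.log C / Real.log x + 1) (𝓝[>] 0) (𝓝 1) := by
    simpa using (Real.tendsto_log_nhdsGT_zero.const_div_atBot (Real.log C)).add_const 1
  refine hlim.congr' ?_
  filter_upwards [Ioo_mem_nhdsGT one_pos] with x hx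
  have := (Real.log_neg hx.1 hx.2).ne
  rw [Real.log_mul hC hx.1.ne']
  field_simp

theorem tendsto_coe_nhdsGT_zero : Tendsto ((↑) : ℝ≥0 → ℝ) (𝓝[>] 0) (𝓝[>] 0) :=
  tendsto_nhdsWithin_of_tendsto_nhds_of_eventually_within _
    (NNReal.continuous_coe.tendsto' 0 0 rfl |>.mono_left nhdsWithin_le_nhds)
    (eventually_mem_nhdsWithin.mono fun _ => NNReal.coe_pos.2)

theorem coveringNumber_ne_top [PseudoMetricSpace M] {A : Set M} (hA : TotallyBounded A)
    {ε : ℝ≥0} (hε : ε ≠ 0) : Metric.coveringNumber ε A ≠ ⊤ := by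
  obtain ⟨S, hSA, hfin, hcov⟩ := Metric.exists_finite_isCover_of_totallyBounded hε hA
  exact ne_top_of_le_ne_top (encard_ne_top_iff.2 hfin) (hcov.coveringNumber_le_encard hSA)

theorem upperRate_le_log_coveringNumber_div [PseudoMetricSpace M] {f : X → X} {T : K → X → M}
    {ε R δ : ℝ≥0} (hN : Metric.coveringNumber ε (univ : Set M) ≠ ⊤) (hR0 : 0 < R) (hR1 : R < 1)
    (hRδ : R < δ) {m : ℕ} (hT : ∀ n : ℕ, ∃ J : Finset K, J.card ≤ n + m ∧
      ∀ x y, (∀ j ∈ J, dist (T j x) (T j y) ≤ 2 * ε) → dynDist ρ f n x y ≤ R) :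
    upperRate ρ f δ ≤ ENNReal.ofReal
      (Real.log (Metric.coveringNumber ε (univ : Set M)).toNat / |Real.log R|) := by
  refine limsup_div_natCast_le (m := m) fun n => ?_
  obtain ⟨J, hJ, hobs⟩ := hT n
  refine (dimScale_le_card_mul_log_coveringNumber_div (T := fun j : J => T j) hN
    (fun x y h => hobs x y fun j hj => h ⟨j, hj⟩) hR0 hR1 hRδ).trans ?_
  rw [Fintype.card_coe]
  gcongr

/- Covering `M` by `N(ε)` balls and observing only `n + m` points of `M` gives a cover of `X` by
`N(ε)^(n + m)` sets whose diameters are comparable to `ε`. -/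
theorem upperMdimH_le_lowerBoxDim [MetricSpace M] (hM : TotallyBounded (univ : Set M))
    {f : X → X} (T : K → X → M) {C : ℝ≥0} (hC : 0 < C)
    (hT : ∀ ε : ℝ≥0, 0 < ε → ∃ m : ℕ, ∀ n : ℕ, ∃ J : Finset K, J.card ≤ n + m ∧
      ∀ x y, (∀ j ∈ J, dist (T j x) (T j y) ≤ 2 * ε) → dynDist ρ f n x y ≤ C * ε) :
    upperMdimH ρ f ≤ lowerBoxDim M := by
  refine le_of_tendsto (tendsto_upperRate ρ f) ?_
  filter_upwards [self_mem_nhdsWithin] with δ hδ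
  let ratio (ε : ℝ≥0) : ℝ≥0∞ := ENNReal.ofReal (Real.log (C * ε) / Real.log ε)
  have ratio_lim : Tendsto (fun ε => upperRate ρ f δ * ratio ε) (𝓝[>] 0)
      (𝓝 (upperRate ρ f δ)) := by
    simpa using ENNReal.Tendsto.const_mul (a := upperRate ρ f δ) (ENNReal.tendsto_ofReal <|
      (tendsto_log_const_mul_div_log (NNReal.coe_ne_zero.2 hC.ne')).comp tendsto_coe_nhdsGT_zero)
      (.inl (by simp))
  rw [← ratio_lim.liminf_eq]
  have hsmall : ∀ᶠ ε in 𝓝[>] 0, C * ε < min δ 1 :=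
    ((continuous_const_mul C).tendsto' 0 0 (mul_zero C) |>.mono_left
      nhdsWithin_le_nhds).eventually_lt_const (lt_min hδ one_pos)
  refine liminf_le_liminf ?_
  filter_upwards [hsmall, Ioo_mem_nhdsGT one_pos] with ε hCε hε
  obtain ⟨hCδ, hC1⟩ := lt_min_iff.1 hCε
  obtain ⟨m, hm⟩ := hT ε hε.1
  have logε_neg : Real.log ε < 0 := Real.log_neg hε.1 hε.2
  have logCε_neg : Real.log (C * ε) < 0 := Real.log_neg (mul_pos hC hε.1) hC1
  have hrate := upperRate_le_log_coveringNumber_div (coveringNumber_ne_top hM hε.1.ne')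
    (mul_pos hC hε.1) hC1 hCδ hm
  calc upperRate ρ f δ * ratio ε
      ≤ ENNReal.ofReal (Real.log (Metric.coveringNumber ε (univ : Set M)).toNat /
          |Real.log (C * ε)|) * ratio ε := by gcongr; exact hrate
    _ = _ := by
      rw [← ENNReal.ofReal_mul (by positivity), abs_of_neg logε_neg, abs_of_neg logCε_neg]
      congr 1
      field_simp [logε_neg.ne, logCε_neg.ne]

theorem upperMdimH_dist_le_lowerBoxDim [MetricSpace M] (hM : TotallyBounded (univ : Set M))
    (f : M → M) : upperMdimH dist f ≤ lowerBoxDim M :=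
  upperMdimH_le_lowerBoxDim hM (fun l : ℕ => f^[l]) two_pos fun ε _ =>
    ⟨0, fun n => ⟨Finset.range n, (Finset.card_range n).le, fun _ _ h =>
      dynDist_le (by positivity) fun l hl => h l (Finset.mem_range.2 hl)⟩⟩

end UpperBound

section ProdDist

variable {K M : Type*}

theorem summable_mul_dist [PseudoMetricSpace M] [BoundedSpace M] {w : K → ℝ} (hw : Summable w)
    (hw0 : ∀ j, 0 ≤ w j) (x y : K → M) : Summable fun j => w j * dist (x j) (y j) :=
  .of_nonneg_of_le (fun j => mul_nonneg (hw0 j) dist_nonneg)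
    (fun j => mul_le_mul_of_nonneg_left
      (Metric.dist_le_diam_of_mem (Bornology.IsBounded.all univ) (mem_univ _) (mem_univ _)) (hw0 j))
    (hw.mul_right (Metric.diam (univ : Set M)))

variable [MetricSpace M] {absIdx : K → ℕ}

theorem edist_le_mul_prodDist {x y : K → M}
    (hs : Summable fun j => 1 / 2 ^ absIdx j * dist (x j) (y j)) (j : K) :
    edist (x j) (y j) ≤ (2 ^ absIdx j : ℝ≥0) * ENNReal.ofReal (prodDist absIdx x y) := by
  have hterm : 1 / 2 ^ absIdx j * dist (x j) (y j) ≤ prodDist absIdx x y :=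
    hs.le_tsum j fun i _ => by positivity
  rw [edist_dist, ← ENNReal.ofReal_coe_nnreal, ← ENNReal.ofReal_mul (by positivity)]
  refine ENNReal.ofReal_le_ofReal ?_
  rwa [one_div_mul_eq_div, div_le_iff₀' (by positivity)] at hterm

theorem prodDist_le [BoundedSpace M]
    (hw : Summable fun j => (1 : ℝ) / 2 ^ absIdx j) {F : Finset K} {η : ℝ} {x y : K → M}
    (hη : 0 ≤ η) (h : ∀ j ∈ F, dist (x j) (y j) ≤ η) :
    prodDist absIdx x y ≤ (∑' j, 1 / 2 ^ absIdx j) * η +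
      (∑' j : {j // j ∉ F}, 1 / 2 ^ absIdx j) * Metric.diam (univ : Set M) := by
  have hw0 (j : K) : (0 : ℝ) ≤ 1 / 2 ^ absIdx j := by positivity
  have hs := summable_mul_dist hw hw0 x y
  rw [prodDist, ← hs.sum_add_tsum_subtype_compl F]
  gcongr ?_ + ?_
  · calc ∑ j ∈ F, 1 / 2 ^ absIdx j * dist (x j) (y j)
        ≤ ∑ j ∈ F, 1 / 2 ^ absIdx j * η :=
          Finset.sum_le_sum fun j hj => mul_le_mul_of_nonneg_left (h j hj) (hw0 j)
      _ = (∑ j ∈ F, 1 / 2 ^ absIdx j) * η := (Finset.sum_mul ..).symm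
      _ ≤ (∑' j, 1 / 2 ^ absIdx j) * η := by
          gcongr
          exact hw.sum_le_tsum F fun j _ => hw0 j
  · rw [← tsum_mul_right]
    refine (hs.subtype _).tsum_le_tsum (fun j => ?_) ((hw.subtype _).mul_right _)
    exact mul_le_mul_of_nonneg_left (Metric.dist_le_diam_of_mem (Bornology.IsBounded.all univ)
      (mem_univ _) (mem_univ _)) (hw0 j)

end ProdDist

section Shift

variable {K M : Type*} [Add K] [One K]

theorem shift_iterate (k : ℕ) (x : K → M) (j : K) : shift^[k] x j = x ((· + 1)^[k] j) := by
  induction k generalizing x with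
  | zero => rfl
  | succ k ih => rw [Function.iterate_succ_apply, ih, Function.iterate_succ_apply', shift]

variable [MetricSpace M] {absIdx : K → ℕ}

theorem dimH_le_lowerMdimH_prodDist
    (hs : ∀ x y : K → M, Summable fun j => 1 / 2 ^ absIdx j * dist (x j) (y j)) (j₀ : K)
    (hj₀ : Function.Injective fun k : ℕ => (· + 1)^[k] j₀) :
    dimH (univ : Set M) ≤ lowerMdimH (prodDist (M := M) absIdx) shift := by
  refine dimH_le_lowerMdimH_of_surjective_itinerary (π := fun x => x j₀)
    (fun x y => edist_le_mul_prodDist (hs x y) j₀) fun y => ?_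
  have : Nonempty M := ⟨y 0⟩
  obtain ⟨x, rfl⟩ := hj₀.surjective_comp_right y
  exact ⟨x, funext fun l => shift_iterate l x j₀⟩

/-- The translates `F, F + 1, …, F + (n - 1)` of every finite set `F` of indices lie in a set of
`n + m` indices, where `m` does not depend on `n`. The index sets `ℕ+` and `ℤ` have this property;
it bounds the number of coordinates seen by `n` iterates of the shift. -/
def HasLinearTranslateGrowth (K : Type*) [Add K] [One K] : Prop :=
  ∀ F : Finset K, ∃ m : ℕ, ∀ n : ℕ, ∃ J : Finset K, J.card ≤ n + m ∧
    ∀ j ∈ F, ∀ k < n, (· + 1)^[k] j ∈ J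

theorem upperMdimH_prodDist_le_lowerBoxDim (hM : TotallyBounded (univ : Set M))
    (hK : HasLinearTranslateGrowth K) (hw : Summable fun j => (1 : ℝ) / 2 ^ absIdx j) :
    upperMdimH (prodDist (M := M) absIdx) shift ≤ lowerBoxDim M := by
  have : BoundedSpace M := ⟨hM.isBounded⟩
  obtain ⟨W, hW⟩ : ∃ W : ℝ≥0, (W : ℝ) = ∑' j, 1 / 2 ^ absIdx j :=
    ⟨⟨_, tsum_nonneg fun j => by positivity⟩, rfl⟩
  refine upperMdimH_le_lowerBoxDim hM (fun j x => x j) (C := W * 2 + 1) (by positivity)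
    fun ε hε => ?_
  have tail_lim := (tendsto_tsum_compl_atTop_zero fun j => (1 : ℝ) / 2 ^ absIdx j).mul_const
    (Metric.diam (univ : Set M))
  rw [zero_mul] at tail_lim
  obtain ⟨F, hF⟩ := (tail_lim.eventually_le_const (NNReal.coe_pos.2 hε)).exists
  obtain ⟨m, hm⟩ := hK F
  refine ⟨m, fun n => (hm n).imp fun J ⟨hcard, hJ⟩ => ⟨hcard, fun x y hxy => ?_⟩⟩
  refine dynDist_le (by positivity) fun l hl => ?_
  calc prodDist absIdx (shift^[l] x) (shift^[l] y)
      ≤ W * (2 * ε) + (∑' j : {j // j ∉ F}, 1 / 2 ^ absIdx j) * Metric.diam (univ : Set M) := by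
        rw [hW]
        refine prodDist_le hw (by positivity) fun j hj => ?_
        simpa only [shift_iterate] using hxy _ (hJ j hj l hl)
    _ ≤ W * (2 * ε) + ε := by gcongr
    _ = (W * 2 + 1 : ℝ≥0) * ε := by push_cast; ring

end Shift

section IndexSets

theorem coe_iterate_add_one_pnat (k : ℕ) (j : ℕ+) : (((· + 1)^[k] j : ℕ+) : ℕ) = j + k := by
  induction k with
  | zero => rfl
  | succ k ih => rw [Function.iterate_succ_apply', PNat.add_coe, ih, PNat.one_coe, add_assoc]

theorem iterate_add_one_int (k : ℕ) (j : ℤ) : (· + 1)^[k] j = j + k := by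
  rw [add_right_iterate_apply, nsmul_one]

theorem hasLinearTranslateGrowth_pnat : HasLinearTranslateGrowth ℕ+ := fun F => by
  set N := F.sup PNat.val
  refine ⟨N + 1, fun n => ⟨Finset.Icc 1 (n + N).succPNat, by simp [add_assoc], fun j hj k hk => ?_⟩⟩
  have hjN : (j : ℕ) ≤ N := Finset.le_sup hj
  rw [Finset.mem_Icc, ← PNat.coe_le_coe _ (Nat.succPNat _), coe_iterate_add_one_pnat,
    Nat.succPNat_coe]
  exact ⟨one_le, by omega⟩

theorem hasLinearTranslateGrowth_int : HasLinearTranslateGrowth ℤ := fun F => by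
  set N := F.sup Int.natAbs
  refine ⟨2 * N, fun n => ⟨Finset.Ico (-N) (n + N), by rw [Int.card_Ico]; omega,
    fun j hj k hk => ?_⟩⟩
  have hjN : j.natAbs ≤ N := Finset.le_sup hj
  rw [Finset.mem_Ico, iterate_add_one_int]
  omega

theorem summable_one_div_two_pow : Summable fun j : ℕ => (1 : ℝ) / 2 ^ j := by
  simpa using summable_geometric_two

theorem summable_one_div_two_pow_pnat : Summable fun j : ℕ+ => (1 : ℝ) / 2 ^ (j : ℕ) :=
  summable_one_div_two_pow.comp_injective PNat.coe_injective

theorem summable_one_div_two_pow_natAbs : Summable fun j : ℤ => (1 : ℝ) / 2 ^ j.natAbs :=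
  .of_nat_of_neg (by simpa using summable_one_div_two_pow) (by simpa using summable_one_div_two_pow)

end IndexSets

end MeanHausdorff

open MeanHausdorff in
theorem mainTheorem5_general {M : Type*} [MetricSpace M] (hM : TotallyBounded (univ : Set M)) :
    (dimH (univ : Set M) ≤ lowerMdimH (prodDistNat (M := M)) shift ∧
      lowerMdimH (prodDistNat (M := M)) shift ≤ upperMdimH (prodDistNat (M := M)) shift ∧
      upperMdimH (prodDistNat (M := M)) shift ≤ lowerBoxDim M) ∧
    (dimH (univ : Set M) ≤ lowerMdimH (prodDistInt (M := M)) shift ∧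
      lowerMdimH (prodDistInt (M := M)) shift ≤ upperMdimH (prodDistInt (M := M)) shift ∧
      upperMdimH (prodDistInt (M := M)) shift ≤ lowerBoxDim M) ∧
    ∀ f : M → M, lowerMdimH (fun x y : M => dist x y) f ≤ upperMdimH (fun x y : M => dist x y) f ∧
      upperMdimH (fun x y : M => dist x y) f ≤ lowerBoxDim M := by
  have : BoundedSpace M := ⟨hM.isBounded⟩
  refine ⟨⟨?_, lowerMdimH_le_upperMdimH .., ?_⟩, ⟨?_, lowerMdimH_le_upperMdimH .., ?_⟩,
    fun f => ⟨lowerMdimH_le_upperMdimH .., upperMdimH_dist_le_lowerBoxDim hM f⟩⟩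
  · refine dimH_le_lowerMdimH_prodDist
      (summable_mul_dist summable_one_div_two_pow_pnat fun j => by positivity) 1 fun k l hkl => ?_
    simpa [coe_iterate_add_one_pnat] using congrArg PNat.val hkl
  · exact upperMdimH_prodDist_le_lowerBoxDim hM hasLinearTranslateGrowth_pnat
      summable_one_div_two_pow_pnat
  · refine dimH_le_lowerMdimH_prodDist
      (summable_mul_dist summable_one_div_two_pow_natAbs fun j => by positivity) 0 fun k l hkl => ?_
    simpa [iterate_add_one_int] using hkl
  · exact upperMdimH_prodDist_le_lowerBoxDim hM hasLinearTranslateGrowth_int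
      summable_one_div_two_pow_natAbs

theorem mainTheorem5 {M : Type*} [MetricSpace M] [CompactSpace M]
    (h : dimH (univ : Set M) = MeanHausdorff.lowerBoxDim M) :
    (MeanHausdorff.lowerMdimH (MeanHausdorff.prodDistNat (M := M)) MeanHausdorff.shift
          = dimH (univ : Set M) ∧
      MeanHausdorff.upperMdimH (MeanHausdorff.prodDistNat (M := M)) MeanHausdorff.shift
          = dimH (univ : Set M)) ∧
    (MeanHausdorff.lowerMdimH (MeanHausdorff.prodDistInt (M := M)) MeanHausdorff.shift
          = dimH (univ : Set M) ∧
      MeanHausdorff.upperMdimH (MeanHausdorff.prodDistInt (M := M)) MeanHausdorff.shift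
          = dimH (univ : Set M)) ∧
    ∀ f : M → M, Continuous f →
      MeanHausdorff.lowerMdimH (fun x y : M => dist x y) f
          ≤ MeanHausdorff.upperMdimH (fun x y : M => dist x y) f ∧
      MeanHausdorff.upperMdimH (fun x y : M => dist x y) f ≤ dimH (univ : Set M) := by
  obtain ⟨⟨dim_leN, lower_leN, upper_leN⟩, ⟨dim_leZ, lower_leZ, upper_leZ⟩, hf⟩ :=
    mainTheorem5_general (M := M) isCompact_univ.totallyBounded
  rw [← h] at upper_leN upper_leZ hf
  exact ⟨⟨(lower_leN.trans upper_leN).antisymm dim_leN,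
      upper_leN.antisymm (dim_leN.trans lower_leN)⟩,
    ⟨(lower_leZ.trans upper_leZ).antisymm dim_leZ, upper_leZ.antisymm (dim_leZ.trans lower_leZ)⟩,
    fun f _ => hf f⟩
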